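/- Identify $\{0,1\}^n$ with $\mathbb F_2^n$. Let $\Delta(P,Q)=\frac12\sum_x|P(x)-Q(x)|$ be the statistical distance, and let $H_\infty(X)=\min_{x\in\operatorname{supp}X}(-\log_2\Pr[X=x])$. Let $P(n,d)$ be the finite set of polynomials in $\mathbb F_2[X_1,\dots,X_n]$ of total degree at most $d$ and individual degrees at most $1$. A map $f:\{0,1\}^n\to\{0,1\}^t$ is an $\eta$-extractor for a family $\mathcal Y$ of distributions over $\{0,1\}^n$ if $\Delta(f(Y),U_t)\le\eta$ for every $Y\in\mathcal Y$, where $U_t$ is uniform on $\{0,1\}^t$. There is an absolute constant $n_0$ such that the following holds for every $n\ge n_0$ and every integer $k\ge 5\log_2 n$. Let $\mathcal X$ be a finite family of distributions over $\{0,1\}^n$, each of min-entropy at least $k$. Let $\varepsilon'\in\mathbb R$, and let $\mathcal Y$ be a family of distributions over $\{0,1\}^n$ such that every $Y\in\mathcal Y$ satisfies $\Delta(Y,Z)\le\varepsilon'$ for some convex combination $Z$ of members of $\mathcal X$. Let $d\ge 6$ and $0\le t<k$ be integers, put $\varepsilon=\left(2d/k^{1/4}\right)^d+\varepsilon'$,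 and assume $\varepsilon\le 1/4$. If $p_1,\dots,p_t$ are independent and uniformly random elements of $P(n,d)$, then with probability at least $$1-|\mathcal X|\cdot e^{\,3n+t+1-30\,\max(k-2t,\,0)^{d/2}/n^2}$$ the map $x\mapsto(p_1(x),\dots,p_t(x))$ is a $t\varepsilon$-extractor for $\mathcal Y$. -/

import Mathlib

noncomputable section

/-- The polynomials over `𝔽₂` in `n` variables of total degree at most `d` and of individual
degrees at most `1`. -/
abbrev DegPoly (n d : ℕ) : Submodule (ZMod 2) (MvPolynomial (Fin n) (ZMod 2)) :=
  MvPolynomial.restrictTotalDegree (Fin n) (ZMod 2) d ⊓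
    MvPolynomial.restrictDegree (Fin n) (ZMod 2) 1

instance DegPoly.instFinite (n d : ℕ) : Finite (DegPoly n d) := by
  have h : Finite (MvPolynomial.restrictTotalDegree (Fin n) (ZMod 2) d) :=
    Module.finite_of_finite (ZMod 2)
  exact Finite.of_injective
    (Submodule.inclusion (inf_le_left : DegPoly n d ≤ _)) (Submodule.inclusion_injective _)

instance DegPoly.instFintype (n d : ℕ) : Fintype (DegPoly n d) := Fintype.ofFinite _

instance DegPoly.instMeasurableSpace (n d : ℕ) : MeasurableSpace (DegPoly n d) := ⊤

/-- The law of `t` independent, uniformly random elements of `DegPoly n d`. -/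
def randomPolys (n d t : ℕ) : MeasureTheory.Measure (Fin t → DegPoly n d) :=
  MeasureTheory.Measure.pi fun _ => (PMF.uniformOfFintype (DegPoly n d)).toMeasure

/-- The map `x ↦ (p₁(x), …, p_t(x))` from `{0,1}ⁿ = 𝔽₂ⁿ` to `{0,1}ᵗ = 𝔽₂ᵗ`. -/
def polyMap {n d t : ℕ} (p : Fin t → DegPoly n d) (x : Fin n → ZMod 2) : Fin t → ZMod 2 :=
  fun i => MvPolynomial.eval x (p i : MvPolynomial (Fin n) (ZMod 2))

/-- Statistical distance `Δ(P, Q) = ½ ∑ₓ |P(x) - Q(x)|` of two distributions on a finite set. -/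
def statDist {α : Type*} [Fintype α] (P Q : PMF α) : ℝ :=
  (1 / 2) * ∑ x, |(P x).toReal - (Q x).toReal|

/-- Min-entropy: the minimum over the support of `P` of `-log₂ P(x)`. (The support is nonempty
and, on a finite type, finite.) -/
def minEntropy {α : Type*} [Fintype α] (P : PMF α) : ℝ :=
  ⨅ x : P.support, -Real.logb 2 (P x).toReal

/-- `Z` is a convex combination of members of `𝒳`: for some weights `w` on `𝒳` that sum to `1`,
`Z = ∑_{X ∈ 𝒳} w(X) X`, i.e. `Z` samples from a `w`-random member of `𝒳`. -/
def IsConvexCombination {α : Type*} (𝒳 : Set (PMF α)) (Z : PMF α) : Prop :=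
  ∃ w : PMF 𝒳, Z = w.bind fun X => (X : PMF α)

/-- `E : {0,1}ⁿ → {0,1}ᵐ` is an `ε`-extractor for the family `𝒴` of distributions on `{0,1}ⁿ`. -/
def IsExtractor {n m : ℕ} (E : (Fin n → ZMod 2) → (Fin m → ZMod 2))
    (𝒴 : Set (PMF (Fin n → ZMod 2))) (ε : ℝ) : Prop :=
  ∀ Y ∈ 𝒴, statDist (Y.map E) (PMF.uniformOfFintype (Fin m → ZMod 2)) ≤ ε

end

/-! Fix one source `X` and regard it as a weight function bounded by `B = 2^{-k}`. The bias of a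
random polynomial against any such weight is subgaussian with a small parameter, for the following
reason.

A set of `2^l` points carries a space of functions of degree at most `d`, of dimension at least
`l.choose d`, on which vanishing on the set forces vanishing (`exists_lowDegreeFun_injective_on`).
Hence it contains a separated subset of that size (`exists_isSeparated_choose_le`), and on a
separated set the values of a uniform polynomial are independent fair bits. Peeling off multiples of
indicators of separated sets, and adding subgaussian parameters by convexity, bounds the parameter
by `mass / √r + M * B` with `r = l.choose d` and `M = 2^l` (`isSubgaussianBias_of_separated`).

This holds for every weight bounded by `B`, so it survives conditioning on earlier output bits: the
`t` polynomials are exposed one at a time, each splitting every current weight in two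
(`card_imbalance_gt_le`). With `l = k / 4` the failure probability for one source is exponentially
small. A union bound over `𝒳` then suffices, because statistical distance is convex and does not
increase under maps. -/

noncomputable section

/-! ### Counting integers of small binary weight -/

/-- The number of `j < s` whose binary expansion has fewer than `D` ones, by recursion on the
halves of `s`. -/
def lowWeightCount : ℕ → ℕ → ℕ
  | _, 0 => 0
  | 0, _ + 1 => 0
  | 1, _ + 1 => 1
  | s + 2, D + 1 => lowWeightCount ((s + 3) / 2) (D + 1) + lowWeightCount ((s + 2) / 2) D
termination_by s => s
decreasing_by all_goals omega

@[simp] lemma lowWeightCount_zero_right (s : ℕ) : lowWeightCount s 0 = 0 := by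
  simp [lowWeightCount]

@[simp] lemma lowWeightCount_zero_left (D : ℕ) : lowWeightCount 0 D = 0 := by
  cases D <;> simp [lowWeightCount]

@[simp] lemma lowWeightCount_one_succ (D : ℕ) : lowWeightCount 1 (D + 1) = 1 := by
  simp [lowWeightCount]

lemma lowWeightCount_succ (s D : ℕ) : lowWeightCount s (D + 1) =
    lowWeightCount ((s + 1) / 2) (D + 1) + lowWeightCount (s / 2) D := by
  match s with
  | 0 => simp
  | 1 => simp
  | s + 2 => rw [lowWeightCount]

lemma lowWeightCount_mono_left (D : ℕ) : Monotone fun s => lowWeightCount s D := by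
  intro a b hab
  induction b using Nat.strong_induction_on generalizing a D with
  | _ b ih =>
    dsimp only
    rcases D with _ | D
    · simp
    rcases a with _ | a
    · simp
    rcases Nat.lt_or_ge b 2 with hb | hb
    · have h1 : a = 0 := by omega
      have h2 : b = 1 := by omega
      simp [h1, h2]
    rw [lowWeightCount_succ (a + 1), lowWeightCount_succ b]
    exact Nat.add_le_add (ih _ (by omega) _ (by omega)) (ih _ (by omega) _ (by omega))

/-- The difference of the counts for `D + 1` and `D` is the number of `j < s` with exactly `D` ones,
which grows with `s`. The additive form avoids truncated subtraction. -/
lemma lowWeightCount_exact_mono (D : ℕ) {a b : ℕ} (hab : a ≤ b) :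
    lowWeightCount a (D + 1) + lowWeightCount b D ≤
      lowWeightCount b (D + 1) + lowWeightCount a D := by
  induction b using Nat.strong_induction_on generalizing a D with
  | _ b ih =>
    rcases D with _ | D
    · simpa using lowWeightCount_mono_left 1 hab
    rcases Nat.lt_or_ge b 2 with hb | hb
    · interval_cases b <;> interval_cases a <;> simp
    have h1 := ih ((b + 1) / 2) (by omega) (D + 1) (a := (a + 1) / 2) (by omega)
    have h2 := ih (b / 2) (by omega) D (a := a / 2) (by omega)
    rw [lowWeightCount_succ a D, lowWeightCount_succ b D, lowWeightCount_succ a (D + 1),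
      lowWeightCount_succ b (D + 1)]
    omega

lemma lowWeightCount_succ_one (s : ℕ) : lowWeightCount (s + 1) 1 = 1 := by
  induction s using Nat.strong_induction_on with
  | _ s ih =>
    rcases s with _ | s
    · simp
    rw [lowWeightCount_succ, show (s + 1 + 1 + 1) / 2 = (s + 1) / 2 + 1 by omega,
      ih _ (by omega)]
    simp

/-- This is the numerical step of the Hilbert function induction, with `u` and `i` the sizes of the
union and intersection of two slices. Halving `u` and `i` reduces it to itself. -/
lemma lowWeightCount_add_le (D : ℕ) {u i : ℕ} (h : i ≤ u) :
    lowWeightCount (u + i) (D + 1) ≤ lowWeightCount u (D + 1) + lowWeightCount i D := by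
  induction hs : u + i using Nat.strong_induction_on generalizing u i D with
  | _ s ih =>
    subst hs
    rcases Nat.eq_zero_or_pos i with rfl | hi
    · simp
    -- For `u = i` the claim is the recursion itself. It is split off because the odd case below
    -- needs `(i + 1) / 2 ≤ u / 2`.
    rcases h.eq_or_lt with rfl | hlt
    · rw [lowWeightCount_succ (i + i)]
      rw [show (i + i + 1) / 2 = i by omega, show (i + i) / 2 = i by omega]
    rcases D with _ | D
    · obtain ⟨v, rfl⟩ : ∃ v, u = v + 1 := ⟨u - 1, by omega⟩
      rw [show v + 1 + i = v + i + 1 by omega]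
      simp [lowWeightCount_succ_one]
    have split : ∀ a b c e : ℕ, b ≤ a → e ≤ c → (u + i + 1) / 2 = a + b → (u + i) / 2 = c + e →
        lowWeightCount (u + i) (D + 1 + 1) ≤
          lowWeightCount a (D + 1 + 1) + lowWeightCount b (D + 1) +
            (lowWeightCount c (D + 1) + lowWeightCount e D) := by
      intro a b c e hba hec h1 h2
      rw [lowWeightCount_succ (u + i), h1, h2]
      exact Nat.add_le_add (ih _ (by omega) _ hba rfl) (ih _ (by omega) _ hec rfl)
    rw [lowWeightCount_succ u, lowWeightCount_succ i]
    -- When both are odd, the rounded-up half of one must be paired with the rounded-down half of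
    -- the other; `lowWeightCount_exact_mono` undoes the resulting swap of the halves of `i`.
    by_cases hodd : u % 2 = 1 ∧ i % 2 = 1
    · have h1 := split ((u + 1) / 2) (i / 2) (u / 2) ((i + 1) / 2) (by omega) (by omega)
        (by omega) (by omega)
      have h2 := lowWeightCount_exact_mono D (show i / 2 ≤ (i + 1) / 2 by omega)
      omega
    · have h1 := split ((u + 1) / 2) ((i + 1) / 2) (u / 2) (i / 2) (by omega) (by omega)
        (by omega) (by omega)
      omega

lemma choose_le_lowWeightCount (l d : ℕ) : l.choose d ≤ lowWeightCount (2 ^ l) (d + 1) := by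
  induction l generalizing d with
  | zero => cases d <;> simp
  | succ l ih =>
    rw [lowWeightCount_succ, show (2 ^ (l + 1) + 1) / 2 = 2 ^ l by omega,
      show 2 ^ (l + 1) / 2 = 2 ^ l by omega]
    rcases d with _ | d
    · simpa using ih 0
    · rw [Nat.choose_succ_succ, add_comm]
      exact Nat.add_le_add (ih _) (ih _)

/-! ### Low-degree functions on a finite set of points -/

section HilbertFunction

/-- The multilinear monomial function with set of variables `A`. -/
def monomialFun {n : ℕ} (A : Finset (Fin n)) (x : Fin n → ZMod 2) : ZMod 2 := ∏ i ∈ A, x i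

/-- The functions on `𝔽₂ⁿ` spanned by the multilinear monomials of degree less than `D`. -/
def lowDegreeFun (n D : ℕ) : Submodule (ZMod 2) ((Fin n → ZMod 2) → ZMod 2) :=
  Submodule.span (ZMod 2) (monomialFun '' {A | A.card < D})

lemma lowDegreeFun_comp_tail {n D : ℕ} {f : (Fin n → ZMod 2) → ZMod 2}
    (hf : f ∈ lowDegreeFun n D) :
    (fun x : Fin (n + 1) → ZMod 2 => f (Fin.tail x)) ∈ lowDegreeFun (n + 1) D := by
  refine Submodule.span_induction (p := fun f _ =>
    (fun x : Fin (n + 1) → ZMod 2 => f (Fin.tail x)) ∈ lowDegreeFun (n + 1) D) ?_ ?_ ?_ ?_ hf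
  · rintro _ ⟨A, hA, rfl⟩
    refine Submodule.subset_span ⟨A.map (Fin.succEmb n), by simpa using hA, ?_⟩
    funext x
    simp [monomialFun, Fin.tail]
  · exact Submodule.zero_mem _
  · intro f g _ _ hf hg
    exact Submodule.add_mem _ hf hg
  · intro a f _ hf
    exact Submodule.smul_mem _ a hf

lemma lowDegreeFun_mul_head {n D : ℕ} {f : (Fin n → ZMod 2) → ZMod 2}
    (hf : f ∈ lowDegreeFun n D) :
    (fun x : Fin (n + 1) → ZMod 2 => x 0 * f (Fin.tail x)) ∈ lowDegreeFun (n + 1) (D + 1) := by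
  refine Submodule.span_induction (p := fun f _ =>
    (fun x : Fin (n + 1) → ZMod 2 => x 0 * f (Fin.tail x)) ∈ lowDegreeFun (n + 1) (D + 1))
    ?_ ?_ ?_ ?_ hf
  · rintro _ ⟨A, hA, rfl⟩
    have h0 : (0 : Fin (n + 1)) ∉ A.map (Fin.succEmb n) := by simp [Fin.succ_ne_zero]
    refine Submodule.subset_span ⟨Finset.cons 0 (A.map (Fin.succEmb n)) h0, by simpa using hA, ?_⟩
    funext x
    simp [monomialFun, Fin.tail]
  · simp only [Pi.zero_apply, mul_zero]
    exact Submodule.zero_mem _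
  · intro f g _ _ hf hg
    convert Submodule.add_mem _ hf hg using 1
    funext x
    simp [mul_add]
  · intro a f _ hf
    convert Submodule.smul_mem _ a hf using 1
    funext x
    simp [mul_left_comm]

/-- The function `f(x') + x₀ g(x')` of `x = (x₀, x')`. -/
def consLinear (n : ℕ) : (((Fin n → ZMod 2) → ZMod 2) × ((Fin n → ZMod 2) → ZMod 2))
    →ₗ[ZMod 2] ((Fin (n + 1) → ZMod 2) → ZMod 2) where
  toFun fg x := fg.1 (Fin.tail x) + x 0 * fg.2 (Fin.tail x)
  map_add' a b := by funext x; simp; ring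
  map_smul' a b := by funext x; simp; ring

lemma consLinear_apply_cons {n : ℕ} (f g : (Fin n → ZMod 2) → ZMod 2) (a : ZMod 2)
    (y : Fin n → ZMod 2) :
    consLinear n (f, g) (Fin.cons a y : Fin (n + 1) → ZMod 2) = f y + a * g y := by
  simp [consLinear]

lemma consLinear_injective (n : ℕ) : Function.Injective (consLinear n) := by
  rw [injective_iff_map_eq_zero]
  rintro ⟨f, g⟩ h
  have h0 : f = 0 := by
    funext y
    simpa [consLinear_apply_cons] using congrFun h (Fin.cons 0 y)
  have h1 : g = 0 := by
    funext y
    simpa [consLinear_apply_cons, h0] using congrFun h (Fin.cons 1 y)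
  simp [h0, h1]

/-- Lower bound for the Hilbert function of `S`. -/
lemma exists_lowDegreeFun_injective_on (n D : ℕ) (S : Finset (Fin n → ZMod 2)) :
    ∃ W ≤ lowDegreeFun n D, lowWeightCount S.card D ≤ Module.finrank (ZMod 2) W ∧
      ∀ f ∈ W, (∀ x ∈ S, f x = 0) → f = 0 := by
  induction n generalizing D with
  | zero =>
    rcases D with _ | D
    · exact ⟨⊥, bot_le, by simp, by simp⟩
    rcases S.eq_empty_or_nonempty with rfl | ⟨x, hx⟩
    · exact ⟨⊥, bot_le, by simp, by simp⟩
    have hS : S.card = 1 :=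
      le_antisymm (Finset.card_le_one_of_subsingleton S) (Finset.card_pos.2 ⟨x, hx⟩)
    refine ⟨Submodule.span (ZMod 2) {monomialFun ∅}, ?_, ?_, ?_⟩
    · exact Submodule.span_mono (by simpa using ⟨∅, by simp, rfl⟩)
    · rw [hS, lowWeightCount_one_succ, finrank_span_singleton]
      intro h
      simpa [monomialFun] using congrFun h x
    · intro f _ hf
      funext y
      rw [Subsingleton.elim y x, hf x hx, Pi.zero_apply]
  | succ n ih =>
    rcases D with _ | D
    · exact ⟨⊥, bot_le, by simp, by simp⟩
    classical
    let slice (a : ZMod 2) : Finset (Fin n → ZMod 2) :=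
      {y | (Fin.cons a y : Fin (n + 1) → ZMod 2) ∈ S}
    have hcard : S.card = (slice 0 ∪ slice 1).card + (slice 0 ∩ slice 1).card := by
      rw [Finset.card_union_add_card_inter]
      have hinj : ∀ (a b : ZMod 2) (y z : Fin n → ZMod 2),
          (Fin.cons a y : Fin (n + 1) → ZMod 2) = Fin.cons b z ↔ a = b ∧ y = z :=
        fun a b y z => Fin.cons_inj
      have hS : S = (slice 0).image (fun y => (Fin.cons 0 y : Fin (n + 1) → ZMod 2)) ∪
          (slice 1).image (fun y => (Fin.cons 1 y : Fin (n + 1) → ZMod 2)) := by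
        ext x
        obtain ⟨a, y, rfl⟩ : ∃ a y, x = (Fin.cons a y : Fin (n + 1) → ZMod 2) :=
          ⟨x 0, Fin.tail x, (Fin.cons_self_tail x).symm⟩
        simp only [slice, Finset.mem_union, Finset.mem_image, Finset.mem_filter,
          Finset.mem_univ, true_and, hinj]
        rcases (by decide : ∀ a : ZMod 2, a = 0 ∨ a = 1) a with rfl | rfl <;> simp
      rw [congrArg Finset.card hS, Finset.card_union_of_disjoint,
        Finset.card_image_of_injective _ (Fin.cons_right_injective (α := fun _ => ZMod 2) 0),
        Finset.card_image_of_injective _ (Fin.cons_right_injective (α := fun _ => ZMod 2) 1)]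
      rw [Finset.disjoint_left]
      simp [hinj]
    -- The new space consists of `f + x₀ g`, with `f` controlled by the union of the slices and `g`,
    -- of degree one less, by their intersection. Over the intersection both `f` and `f + g` vanish,
    -- so `g = 0`; then `f` vanishes on the union.
    obtain ⟨W, hW, hWr, hWi⟩ := ih (D + 1) (slice 0 ∪ slice 1)
    obtain ⟨W', hW', hWr', hWi'⟩ := ih D (slice 0 ∩ slice 1)
    let Ψ := (consLinear n).comp (W.subtype.prodMap W'.subtype)
    have hΨ : Function.Injective Ψ := (consLinear_injective n).comp
      (Function.Injective.prodMap W.injective_subtype W'.injective_subtype)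
    refine ⟨LinearMap.range Ψ, ?_, ?_, ?_⟩
    · rintro _ ⟨⟨⟨f, hf⟩, ⟨g, hg⟩⟩, rfl⟩
      exact Submodule.add_mem _ (lowDegreeFun_comp_tail (hW hf))
        (lowDegreeFun_mul_head (hW' hg))
    · rw [LinearMap.finrank_range_of_inj hΨ, Module.finrank_prod, hcard]
      refine (lowWeightCount_add_le D (Finset.card_le_card ?_)).trans (Nat.add_le_add hWr hWr')
      exact Finset.inter_subset_left.trans Finset.subset_union_left
    · rintro _ ⟨⟨⟨f, hf⟩, ⟨g, hg⟩⟩, rfl⟩ h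
      change ∀ x ∈ S, consLinear n (f, g) x = 0 at h
      change consLinear n (f, g) = 0
      have hv : ∀ a y, y ∈ slice a → f y + a * g y = 0 := by
        intro a y hy
        rw [← consLinear_apply_cons]
        exact h _ (by simpa [slice] using hy)
      have hg0 : g = 0 := by
        refine hWi' g hg fun y hy => ?_
        rw [Finset.mem_inter] at hy
        simpa [show f y = 0 by simpa using hv 0 y hy.1] using hv 1 y hy.2
      have hf0 : f = 0 := by
        refine hWi f hf fun y hy => ?_
        rcases Finset.mem_union.1 hy with hy | hy
        · simpa [hg0] using hv 0 y hy
        · simpa [hg0] using hv 1 y hy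
      rw [hf0, hg0]
      exact map_zero _

/-- Evaluation of the polynomials in `DegPoly n d` at all points. -/
def DegPoly.evalLinear (n d : ℕ) : DegPoly n d →ₗ[ZMod 2] ((Fin n → ZMod 2) → ZMod 2) where
  toFun p x := MvPolynomial.eval x (p : MvPolynomial (Fin n) (ZMod 2))
  map_add' p q := by funext x; simp
  map_smul' a p := by funext x; simp

lemma lowDegreeFun_le_range (n d : ℕ) :
    lowDegreeFun n (d + 1) ≤ LinearMap.range (DegPoly.evalLinear n d) := by
  refine Submodule.span_le.2 ?_
  rintro _ ⟨A, hA, rfl⟩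
  have hA : A.card ≤ d := Nat.lt_succ_iff.1 hA
  have hX : (∏ i ∈ A, MvPolynomial.X i : MvPolynomial (Fin n) (ZMod 2)) =
      MvPolynomial.monomial (∑ i ∈ A, Finsupp.single i 1) 1 := by
    rw [MvPolynomial.monomial_sum_one]; rfl
  have hdeg : ∀ j, (∑ i ∈ A, Finsupp.single i 1 : Fin n →₀ ℕ) j ≤ 1 := by
    intro j
    simp only [Finsupp.coe_finsetSum, Finset.sum_apply, Finsupp.single_apply]
    rw [Finset.sum_ite_eq']
    split_ifs <;> simp
  refine ⟨⟨∏ i ∈ A, MvPolynomial.X i, ?_, ?_⟩, ?_⟩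
  · refine (MvPolynomial.mem_restrictTotalDegree _ _ _).2 ?_
    refine (MvPolynomial.totalDegree_finsetProd _ _).trans ?_
    simpa using hA
  · refine (MvPolynomial.mem_restrictDegree _ _ _).2 ?_
    intro s hs i
    rw [hX] at hs
    rw [Finset.mem_singleton.1 (MvPolynomial.support_monomial_subset hs)]
    exact hdeg i
  · funext x
    simp [DegPoly.evalLinear, monomialFun]

end HilbertFunction

/-! ### Separated sets -/

/-- Each point of `T` is separated from the others by a member of `V`. -/
def IsSeparated {V Ω : Type*} (e : V → Ω → ZMod 2) (T : Finset Ω) : Prop :=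
  ∀ x ∈ T, ∃ q, e q x = 1 ∧ ∀ y ∈ T, y ≠ x → e q y = 0

/-- Take `T` maximal. If some `f` in the range vanished on `T` but not at `x ∈ S`, then `x` could be
adjoined: `f` separates it, and the old separators are corrected by multiples of `f`. So restriction
to `T` is injective on `W`. -/
lemma exists_isSeparated_finrank_le {V Ω : Type*} [AddCommGroup V] [Module (ZMod 2) V]
    (e : V →ₗ[ZMod 2] (Ω → ZMod 2)) (S : Finset Ω) (W : Submodule (ZMod 2) (Ω → ZMod 2))
    (hW : W ≤ LinearMap.range e) (hS : ∀ f ∈ W, (∀ x ∈ S, f x = 0) → f = 0) :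
    ∃ T ⊆ S, IsSeparated e T ∧ Module.finrank (ZMod 2) W ≤ T.card := by
  classical
  obtain ⟨T, hT, hmax⟩ := (S.powerset.filter fun T => IsSeparated e T).exists_max_image
    Finset.card ⟨∅, Finset.mem_filter.2 ⟨by simp, by simp [IsSeparated]⟩⟩
  rw [Finset.mem_filter, Finset.mem_powerset] at hT
  refine ⟨T, hT.1, hT.2, ?_⟩
  have hvan : ∀ f, (∀ x ∈ T, e f x = 0) → ∀ x ∈ S, e f x = 0 := by
    intro f hf x hx
    by_contra hne
    have h1 : e f x = 1 := by
      generalize e f x = a at hne ⊢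
      fin_cases a
      · exact absurd rfl hne
      · rfl
    have hxT : x ∉ T := fun h => hne (hf x h)
    have hsep : IsSeparated e (insert x T) := by
      intro y hy
      rcases Finset.mem_insert.1 hy with rfl | hy
      · refine ⟨f, h1, fun z hz hzy => ?_⟩
        exact hf z ((Finset.mem_insert.1 hz).resolve_left hzy)
      · obtain ⟨q, hq, hq'⟩ := hT.2 y hy
        refine ⟨q - e q x • f, by simp [hq, hf y hy], fun z hz hzy => ?_⟩
        rcases Finset.mem_insert.1 hz with rfl | hz
        · simp [h1]
        · simp [hq' z hz hzy, hf z hz]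
    have := hmax (insert x T) (Finset.mem_filter.2
      ⟨Finset.mem_powerset.2 (Finset.insert_subset hx hT.1), hsep⟩)
    rw [Finset.card_insert_of_notMem hxT] at this
    omega
  let ρ : W →ₗ[ZMod 2] (T → ZMod 2) :=
    (LinearMap.funLeft (ZMod 2) (ZMod 2) (Subtype.val : T → Ω)).comp W.subtype
  have hρ : Function.Injective ρ := by
    rw [injective_iff_map_eq_zero]
    rintro ⟨f, hf⟩ h
    obtain ⟨q, rfl⟩ := hW hf
    have h0 : ∀ x ∈ T, e q x = 0 := fun x hx => congrFun h ⟨x, hx⟩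
    exact Subtype.ext (hS _ hf (hvan q h0))
  simpa using LinearMap.finrank_le_finrank_of_injective hρ

lemma exists_isSeparated_choose_le {n d l : ℕ} (S : Finset (Fin n → ZMod 2))
    (hS : 2 ^ l ≤ S.card) :
    ∃ T ⊆ S, IsSeparated (DegPoly.evalLinear n d) T ∧ l.choose d ≤ T.card := by
  obtain ⟨W, hW, hr, hi⟩ := exists_lowDegreeFun_injective_on n (d + 1) S
  obtain ⟨T, hTS, hT, hc⟩ := exists_isSeparated_finrank_le (DegPoly.evalLinear n d) S W
    (hW.trans (lowDegreeFun_le_range n d)) hi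
  exact ⟨T, hTS, hT, (choose_le_lowWeightCount l d).trans
    ((lowWeightCount_mono_left _ hS).trans (hr.trans hc))⟩

/-! ### Subgaussian bias of a random function -/

section Subgaussian

/-- The sign `(-1)^a`. -/
def bitSign (a : ZMod 2) : ℝ := if a = 0 then 1 else -1

lemma bitSign_add_one (a : ZMod 2) : bitSign (a + 1) = -bitSign a := by
  rcases (by decide : ∀ a : ZMod 2, a = 0 ∨ a = 1) a with rfl | rfl
  · simp [bitSign]
  · simp [bitSign, show (1 : ZMod 2) + 1 = 0 from rfl]

lemma cosh_mul_bitSign (t : ℝ) (a : ZMod 2) :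
    Real.exp (t * bitSign a) + Real.exp (t * -bitSign a) = 2 * Real.cosh t := by
  rw [Real.cosh_eq]
  unfold bitSign
  split_ifs <;> simp <;> ring

variable {V Ω : Type*} [AddCommGroup V] [Module (ZMod 2) V] [Fintype V]
  (e : V →ₗ[ZMod 2] (Ω → ZMod 2))

/-- Translation by the function `q` separating `x` permutes `V` and flips the sign at `x` only.
Averaging the sum with its translate extracts a factor `cosh s ≤ exp (s ^ 2 / 2)` for each point. -/
lemma IsSeparated.sum_exp_le {T : Finset Ω} (hT : IsSeparated e T) (s : ℝ) :
    ∑ p, Real.exp (s * ∑ x ∈ T, bitSign (e p x)) ≤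
      Fintype.card V * Real.exp (s ^ 2 / 2) ^ T.card := by
  classical
  induction T using Finset.induction_on with
  | empty => simp
  | insert x T hx ih =>
    obtain ⟨q, hq, hq'⟩ := hT x (Finset.mem_insert_self _ _)
    have hT' : IsSeparated e T := by
      intro y hy
      obtain ⟨f, hf, hf'⟩ := hT y (Finset.mem_insert_of_mem hy)
      exact ⟨f, hf, fun z hz => hf' z (Finset.mem_insert_of_mem hz)⟩
    have hshift : ∑ p, Real.exp (s * ∑ y ∈ insert x T, bitSign (e p y)) =
        ∑ p, Real.exp (s * ∑ y ∈ T, bitSign (e p y)) * Real.exp (s * -bitSign (e p x)) := by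
      rw [← Equiv.sum_comp (Equiv.addRight q)]
      refine Finset.sum_congr rfl fun p _ => ?_
      rw [Finset.sum_insert hx, ← Real.exp_add]
      congr 1
      have h1 : ∑ y ∈ T, bitSign (e (p + q) y) = ∑ y ∈ T, bitSign (e p y) := by
        refine Finset.sum_congr rfl fun y hy => ?_
        rw [map_add, Pi.add_apply, hq' y (Finset.mem_insert_of_mem hy)
          (fun h => hx (h ▸ hy)), add_zero]
      simp only [Equiv.coe_addRight]
      rw [h1, map_add, Pi.add_apply, hq, bitSign_add_one]
      ring
    have hsame : ∑ p, Real.exp (s * ∑ y ∈ insert x T, bitSign (e p y)) =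
        ∑ p, Real.exp (s * ∑ y ∈ T, bitSign (e p y)) * Real.exp (s * bitSign (e p x)) := by
      refine Finset.sum_congr rfl fun p _ => ?_
      rw [Finset.sum_insert hx, ← Real.exp_add]
      congr 1
      ring
    have htwo : 2 * ∑ p, Real.exp (s * ∑ y ∈ insert x T, bitSign (e p y)) =
        2 * (Real.cosh s * ∑ p, Real.exp (s * ∑ y ∈ T, bitSign (e p y))) := by
      rw [two_mul]
      nth_rewrite 1 [hsame]
      rw [hshift, ← Finset.sum_add_distrib, Finset.mul_sum, Finset.mul_sum]
      refine Finset.sum_congr rfl fun p _ => ?_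
      rw [← mul_add, cosh_mul_bitSign]
      ring
    rw [mul_left_cancel₀ two_ne_zero htwo, Finset.card_insert_of_notMem hx, pow_succ, ← mul_assoc,
      mul_comm]
    have h0 : 0 ≤ ∑ p, Real.exp (s * ∑ y ∈ T, bitSign (e p y)) :=
      Finset.sum_nonneg fun _ _ => (Real.exp_pos _).le
    exact mul_le_mul (ih hT') (Real.cosh_le_exp_half_sq s) (Real.cosh_pos s).le
      (h0.trans (ih hT'))

variable [Fintype Ω]

/-- The bias `∑ₓ w(x) (-1)^{p(x)}`. -/
def signedSum (w : Ω → ℝ) (p : V) : ℝ := ∑ x, w x * bitSign (e p x)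

/-- For uniformly random `p`, the bias of `p` is subgaussian with variance proxy `σ ^ 2`. -/
def IsSubgaussianBias (w : Ω → ℝ) (σ : ℝ) : Prop :=
  ∀ s : ℝ, ∑ p, Real.exp (s * signedSum e w p) ≤ Fintype.card V * Real.exp (s ^ 2 * σ ^ 2 / 2)

variable {e}

lemma IsSeparated.isSubgaussianBias [DecidableEq Ω] {T : Finset Ω} (hT : IsSeparated e T) (θ : ℝ) :
    IsSubgaussianBias e (fun x => if x ∈ T then θ else 0) (θ * √T.card) := by
  intro s
  have h1 : ∀ p, s * signedSum e (fun x => if x ∈ T then θ else 0) p =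
      s * θ * ∑ x ∈ T, bitSign (e p x) := by
    intro p
    simp only [signedSum, ite_mul, zero_mul, Finset.sum_ite_mem, Finset.univ_inter]
    rw [← Finset.mul_sum]
    ring
  simp only [h1]
  refine (hT.sum_exp_le e (s * θ)).trans (le_of_eq ?_)
  rw [← Real.exp_nat_mul, mul_pow θ, Real.sq_sqrt (Nat.cast_nonneg _)]
  congr 2
  ring

lemma IsSubgaussianBias.mono {w : Ω → ℝ} {σ σ' : ℝ} (h : IsSubgaussianBias e w σ) (h0 : 0 ≤ σ)
    (hσ : σ ≤ σ') : IsSubgaussianBias e w σ' := by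
  intro s
  refine (h s).trans ?_
  gcongr

/-- The two biases may be dependent, so the parameters add, rather than their squares. Convexity of
`exp` with weights proportional to `σ` and `σ'` makes both exponents equal. -/
lemma IsSubgaussianBias.add {w w' : Ω → ℝ} {σ σ' : ℝ} (h : IsSubgaussianBias e w σ)
    (h' : IsSubgaussianBias e w' σ') (hσ : 0 < σ) (hσ' : 0 < σ') :
    IsSubgaussianBias e (fun x => w x + w' x) (σ + σ') := by
  intro s
  have hpos : 0 < σ + σ' := by positivity
  have hconv : ∀ p, Real.exp (s * signedSum e (fun x => w x + w' x) p) ≤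
      σ / (σ + σ') * Real.exp (s * (σ + σ') / σ * signedSum e w p) +
        σ' / (σ + σ') * Real.exp (s * (σ + σ') / σ' * signedSum e w' p) := by
    intro p
    have hc := convexOn_exp.2 (Set.mem_univ (s * (σ + σ') / σ * signedSum e w p))
      (Set.mem_univ (s * (σ + σ') / σ' * signedSum e w' p))
      (show 0 ≤ σ / (σ + σ') by positivity) (show 0 ≤ σ' / (σ + σ') by positivity)
      (by field_simp)
    have hs : s * signedSum e (fun x => w x + w' x) p =
        σ / (σ + σ') * (s * (σ + σ') / σ * signedSum e w p) +
          σ' / (σ + σ') * (s * (σ + σ') / σ' * signedSum e w' p) := by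
      simp only [signedSum, add_mul, Finset.sum_add_distrib]
      field_simp
    rw [hs]
    simpa only [smul_eq_mul] using hc
  calc ∑ p, Real.exp (s * signedSum e (fun x => w x + w' x) p)
      ≤ σ / (σ + σ') * ∑ p, Real.exp (s * (σ + σ') / σ * signedSum e w p) +
        σ' / (σ + σ') * ∑ p, Real.exp (s * (σ + σ') / σ' * signedSum e w' p) := by
        rw [Finset.mul_sum, Finset.mul_sum, ← Finset.sum_add_distrib]
        exact Finset.sum_le_sum fun p _ => hconv p
    _ ≤ σ / (σ + σ') * (Fintype.card V * Real.exp ((s * (σ + σ') / σ) ^ 2 * σ ^ 2 / 2)) +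
        σ' / (σ + σ') * (Fintype.card V * Real.exp ((s * (σ + σ') / σ') ^ 2 * σ' ^ 2 / 2)) := by
        have h1 := h (s * (σ + σ') / σ)
        have h2 := h' (s * (σ + σ') / σ')
        gcongr
    _ = Fintype.card V * Real.exp (s ^ 2 * (σ + σ') ^ 2 / 2) := by
        rw [show (s * (σ + σ') / σ) ^ 2 * σ ^ 2 / 2 = s ^ 2 * (σ + σ') ^ 2 / 2 by field_simp,
          show (s * (σ + σ') / σ') ^ 2 * σ' ^ 2 / 2 = s ^ 2 * (σ + σ') ^ 2 / 2 by field_simp]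
        field_simp

/-- Removal of the part `θ · 1_T` of a weight function. -/
lemma IsSubgaussianBias.of_sub_indicator [DecidableEq Ω] {w : Ω → ℝ} {T : Finset Ω}
    (hT : IsSeparated e T) {θ σ : ℝ}
    (hθ : 0 < θ) (hne : T.Nonempty) (hσ : 0 < σ)
    (h : IsSubgaussianBias e (fun x => w x - if x ∈ T then θ else 0) σ) :
    IsSubgaussianBias e w (σ + θ * √T.card) := by
  have hc : (0 : ℝ) < T.card := by exact_mod_cast hne.card_pos
  have := h.add (hT.isSubgaussianBias θ) hσ (by positivity)
  simpa using this

/-- Points are peeled off singly; a singleton is separated by the constant `1`. The slack `η` keeps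
the parameter positive, as `IsSubgaussianBias.add` requires. -/
lemma isSubgaussianBias_sum_add (hone : ∃ q, ∀ x, e q x = 1) {η : ℝ} (hη : 0 < η) (w : Ω → ℝ)
    (hw : ∀ x, 0 ≤ w x) : IsSubgaussianBias e w (∑ x, w x + η) := by
  classical
  induction hm : (Finset.univ.filter fun x => w x ≠ 0).card using Nat.strong_induction_on
    generalizing w with
  | _ m ih =>
    subst hm
    rcases (Finset.univ.filter fun x => w x ≠ 0).eq_empty_or_nonempty with h0 | ⟨x, hx⟩
    · have hz : ∀ x, w x = 0 := by
        intro x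
        by_contra h
        exact absurd (Finset.mem_filter.2 ⟨Finset.mem_univ x, h⟩) (h0 ▸ Finset.notMem_empty x)
      intro s
      simp only [signedSum, hz, zero_mul, Finset.sum_const_zero, mul_zero, Real.exp_zero,
        Finset.sum_const, nsmul_eq_mul, mul_one, Finset.card_univ]
      exact le_mul_of_one_le_right (Nat.cast_nonneg _) (Real.one_le_exp (by positivity))
    · have hx' : w x ≠ 0 := (Finset.mem_filter.1 hx).2
      have hsep : IsSeparated e ({x} : Finset Ω) := by
        obtain ⟨q, hq⟩ := hone
        intro y _
        refine ⟨q, hq y, fun z hz hzy => absurd ?_ hzy⟩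
        simp_all
      have hnn : ∀ y, 0 ≤ w y - if y ∈ ({x} : Finset Ω) then w x else 0 := by
        intro y
        rcases eq_or_ne y x with rfl | hy
        · simp
        · simpa [hy] using hw y
      have hsub := ih _ (Finset.card_lt_card ?_) _ hnn rfl
      · have hpos : 0 < w x := lt_of_le_of_ne (hw x) (Ne.symm hx')
        have := hsub.of_sub_indicator hsep hpos (Finset.singleton_nonempty x)
          (add_pos_of_nonneg_of_pos (Finset.sum_nonneg fun y _ => hnn y) hη)
        convert this using 1
        simp only [Finset.sum_sub_distrib, Finset.mem_singleton, Finset.sum_ite_eq',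
          Finset.mem_univ, if_true, Finset.card_singleton, Nat.cast_one, Real.sqrt_one, mul_one]
        ring
      · refine (Finset.ssubset_iff_of_subset ?_).2 ⟨x, hx, by simp⟩
        intro y hy
        rw [Finset.mem_filter] at hy ⊢
        refine ⟨Finset.mem_univ y, fun h => hy.2 ?_⟩
        rcases eq_or_ne y x with rfl | hyx
        · simp
        · simp [hyx, h]

/-- Greedy peeling: while the support has at least `M` points, it contains a large separated set,
and a multiple of its indicator is removed at cost at most its mass over `√r`. The remainder costs
at most `M * B`. -/
lemma isSubgaussianBias_of_separated (hone : ∃ q, ∀ x, e q x = 1) {M r : ℕ} (hr : 0 < r)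
    (hM : ∀ S : Finset Ω, M ≤ S.card → ∃ T ⊆ S, IsSeparated e T ∧ r ≤ T.card)
    {B : ℝ} (hB : 0 < B) (w : Ω → ℝ) (hw : ∀ x, 0 ≤ w x) (hwB : ∀ x, w x ≤ B) :
    IsSubgaussianBias e w ((∑ x, w x) / √r + M * B) := by
  classical
  induction hm : (Finset.univ.filter fun x => w x ≠ 0).card using Nat.strong_induction_on
    generalizing w with
  | _ m ih =>
    subst hm
    have hsum0 : 0 ≤ ∑ x, w x := Finset.sum_nonneg fun x _ => hw x
    have hr' : (0 : ℝ) < r := by exact_mod_cast hr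
    rcases Nat.lt_or_ge (Finset.univ.filter fun x => w x ≠ 0).card M with hlt | hge
    -- At most `M - 1` points remain, of mass at most `(M - 1) * B`; one more `B` serves as the
    -- slack `η`.
    · refine (isSubgaussianBias_sum_add hone hB w hw).mono (by positivity) ?_
      have h1 : ∑ x, w x ≤ (Finset.univ.filter fun x => w x ≠ 0).card * B := by
        rw [← Finset.sum_filter_ne_zero, ← nsmul_eq_mul]
        exact Finset.sum_le_card_nsmul _ _ _ fun x _ => hwB x
      have h2 : ((Finset.univ.filter fun x => w x ≠ 0).card : ℝ) + 1 ≤ M := by exact_mod_cast hlt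
      have h3 : (((Finset.univ.filter fun x => w x ≠ 0).card : ℝ) + 1) * B ≤ M * B := by gcongr
      have h4 : 0 ≤ (∑ x, w x) / √r := by positivity
      linarith
    · obtain ⟨T, hTS, hT, hrT⟩ := hM _ hge
      have hne : T.Nonempty := Finset.card_pos.1 (hr.trans_le hrT)
      -- Removing the minimum of `w` over `T` keeps the weight nonnegative and deletes `z` from the
      -- support.
      obtain ⟨z, hz, hmin⟩ := T.exists_min_image w hne
      have hz0 : 0 < w z := lt_of_le_of_ne (hw z) (Ne.symm (Finset.mem_filter.1 (hTS hz)).2)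
      have hnn : ∀ y, 0 ≤ w y - if y ∈ T then w z else 0 := by
        intro y
        split_ifs with hy
        · linarith [hmin y hy]
        · simpa using hw y
      have hle : ∀ y, (w y - if y ∈ T then w z else 0) ≤ B := by
        intro y
        split_ifs
        · linarith [hwB y]
        · simpa using hwB y
      -- `M = 0` is impossible: the empty set would contain a set of `r > 0` points.
      have hM0 : (0 : ℝ) < M := by
        rcases Nat.eq_zero_or_pos M with rfl | h
        · obtain ⟨T', hT', -, hc⟩ := hM ∅ (by simp)
          rw [Finset.subset_empty.1 hT'] at hc
          simp at hc
          omega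
        · exact_mod_cast h
      have hsub := ih _ (Finset.card_lt_card ?_) _ hnn hle rfl
      · have hsub0 : 0 ≤ ∑ y, (w y - if y ∈ T then w z else 0) :=
          Finset.sum_nonneg fun y _ => hnn y
        refine (hsub.of_sub_indicator hT hz0 hne (by positivity)).mono (by positivity) ?_
        have hT' : (0 : ℝ) < T.card := by exact_mod_cast hne.card_pos
        have h1 : √(T.card : ℝ) ≤ T.card / √r := by
          rw [le_div_iff₀ (by positivity)]
          calc √(T.card : ℝ) * √r ≤ √(T.card : ℝ) * √T.card := by gcongr
            _ = T.card := Real.mul_self_sqrt hT'.le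
        have h2 : ∑ y, (w y - if y ∈ T then w z else 0) = ∑ y, w y - T.card * w z := by
          simp [Finset.sum_sub_distrib]
        have h3 : w z * √(T.card : ℝ) ≤ w z * (T.card / √r) := by gcongr
        rw [h2, sub_div]
        have h4 : w z * (T.card / √r) = T.card * w z / √r := by ring
        linarith
      · refine (Finset.ssubset_iff_of_subset ?_).2 ⟨z, hTS hz, by simp [hz]⟩
        intro y hy
        rw [Finset.mem_filter] at hy ⊢
        refine ⟨Finset.mem_univ y, fun h => hy.2 ?_⟩
        have : y ∉ T := fun hyT => (Finset.mem_filter.1 (hTS hyT)).2 h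
        simp [this, h]

/-- Chernoff's bound with the optimal exponents `s = ± a / σ ^ 2`, one for each tail. -/
lemma IsSubgaussianBias.card_le {w : Ω → ℝ} {σ : ℝ} (h : IsSubgaussianBias e w σ) (hσ : 0 < σ)
    {a : ℝ} (ha : 0 ≤ a) :
    ((Finset.univ.filter fun p => a < |signedSum e w p|).card : ℝ) ≤
      2 * Real.exp (-(a ^ 2 / (2 * σ ^ 2))) * Fintype.card V := by
  classical
  have hexp : ∀ s : ℝ, s = a / σ ^ 2 ∨ s = -(a / σ ^ 2) →
      ∑ p, Real.exp (s * signedSum e w p) ≤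
        Fintype.card V * Real.exp (a ^ 2 / (2 * σ ^ 2)) := by
    intro s hs
    refine (h s).trans (le_of_eq ?_)
    congr 2
    rcases hs with rfl | rfl <;> field_simp
  have hp : ∀ p, (if a < |signedSum e w p| then Real.exp (a ^ 2 / σ ^ 2) else 0) ≤
      Real.exp (a / σ ^ 2 * signedSum e w p) + Real.exp (-(a / σ ^ 2) * signedSum e w p) := by
    intro p
    have hc : 0 ≤ a / σ ^ 2 := by positivity
    split_ifs with hlt
    · have ha2 : a ^ 2 / σ ^ 2 = a / σ ^ 2 * a := by ring
      rcases lt_abs.1 hlt with h1 | h1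
      · refine le_add_of_le_of_nonneg (Real.exp_le_exp.2 ?_) (Real.exp_pos _).le
        rw [ha2]
        gcongr
      · refine le_add_of_nonneg_of_le (Real.exp_pos _).le (Real.exp_le_exp.2 ?_)
        rw [ha2, neg_mul_comm]
        gcongr
    · positivity
  have hsum := Finset.sum_le_sum fun p (_ : p ∈ Finset.univ) => hp p
  rw [← Finset.sum_filter, Finset.sum_const, nsmul_eq_mul, Finset.sum_add_distrib] at hsum
  have h1 := hexp _ (Or.inl rfl)
  have h2 := hexp _ (Or.inr rfl)
  have h3 : Real.exp (a ^ 2 / (2 * σ ^ 2)) =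
      Real.exp (-(a ^ 2 / (2 * σ ^ 2))) * Real.exp (a ^ 2 / σ ^ 2) := by
    rw [← Real.exp_add]
    congr 1
    field_simp
    ring
  refine le_of_mul_le_mul_right (hsum.trans ((add_le_add h1 h2).trans (le_of_eq ?_)))
    (Real.exp_pos (a ^ 2 / σ ^ 2))
  rw [h3]
  ring

end Subgaussian

/-! ### Exposing the output bits one at a time -/

section Iteration

variable {V Ω : Type*} [AddCommGroup V] [Module (ZMod 2) V] [Fintype Ω]
  (e : V →ₗ[ZMod 2] (Ω → ZMod 2))

/-- The `w`-mass of the points at which `p` takes the value `v`. -/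
def fiberMass {t : ℕ} (w : Ω → ℝ) (p : Fin t → V) (v : Fin t → ZMod 2) : ℝ :=
  ∑ x, if (fun i => e (p i) x) = v then w x else 0

/-- The `ℓ¹` distance of the distribution of the values of `p` from uniform. -/
def imbalance {t : ℕ} (w : Ω → ℝ) (p : Fin t → V) : ℝ :=
  ∑ v, |fiberMass e w p v - (∑ x, w x) / 2 ^ t|

/-- The part of `w` on which `p` takes the value `b`. -/
def restrictWeight (w : Ω → ℝ) (p : V) (b : ZMod 2) (x : Ω) : ℝ := if e p x = b then w x else 0

lemma sum_restrictWeight (w : Ω → ℝ) (p : V) :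
    ∑ x, restrictWeight e w p 0 x + ∑ x, restrictWeight e w p 1 x = ∑ x, w x := by
  rw [← Finset.sum_add_distrib]
  refine Finset.sum_congr rfl fun x _ => ?_
  unfold restrictWeight
  rcases (by decide : ∀ a : ZMod 2, a = 0 ∨ a = 1) (e p x) with h | h <;> simp [h]

lemma sum_restrictWeight_sub (w : Ω → ℝ) (p : V) :
    ∑ x, restrictWeight e w p 0 x - ∑ x, restrictWeight e w p 1 x = signedSum e w p := by
  unfold signedSum
  rw [← Finset.sum_sub_distrib]
  refine Finset.sum_congr rfl fun x _ => ?_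
  unfold restrictWeight bitSign
  rcases (by decide : ∀ a : ZMod 2, a = 0 ∨ a = 1) (e p x) with h | h <;> simp [h]

lemma fiberMass_cons {t : ℕ} (w : Ω → ℝ) (p₀ : V) (p : Fin t → V) (b : ZMod 2)
    (v : Fin t → ZMod 2) :
    fiberMass e w (Fin.cons p₀ p : Fin (t + 1) → V) (Fin.cons b v : Fin (t + 1) → ZMod 2) =
      fiberMass e (restrictWeight e w p₀ b) p v := by
  unfold fiberMass restrictWeight
  refine Finset.sum_congr rfl fun x _ => ?_
  rw [← ite_and]
  refine if_congr ?_ rfl rfl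
  constructor
  · intro h
    exact ⟨funext fun i => by simpa using congrFun h i.succ, by simpa using congrFun h 0⟩
  · rintro ⟨h, h'⟩
    funext i
    refine Fin.cases ?_ (fun j => ?_) i
    · simpa using h'
    · simpa using congrFun h j

/-- The masses of the two parts differ from half the total by `|signedSum| / 2` each. Recentring
each part at its own mean costs this amount, spread over the `2 ^ t` values. -/
lemma imbalance_cons_le {t : ℕ} (w : Ω → ℝ) (p₀ : V) (p : Fin t → V) :
    imbalance e w (Fin.cons p₀ p : Fin (t + 1) → V) ≤
      imbalance e (restrictWeight e w p₀ 0) p + imbalance e (restrictWeight e w p₀ 1) p +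
        |signedSum e w p₀| := by
  have hsplit : imbalance e w (Fin.cons p₀ p : Fin (t + 1) → V) =
      ∑ v, |fiberMass e (restrictWeight e w p₀ 0) p v - (∑ x, w x) / 2 ^ (t + 1)| +
        ∑ v, |fiberMass e (restrictWeight e w p₀ 1) p v - (∑ x, w x) / 2 ^ (t + 1)| := by
    unfold imbalance
    rw [← Equiv.sum_comp (Fin.consEquiv fun _ => ZMod 2), Fintype.sum_prod_type]
    refine (Fin.sum_univ_two _).trans ?_
    simp only [← fiberMass_cons]
    rfl
  have hsum := sum_restrictWeight e w p₀
  have hsub := sum_restrictWeight_sub e w p₀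
  have hb : ∀ b : ZMod 2, |∑ x, restrictWeight e w p₀ b x - (∑ x, w x) / 2| =
      |signedSum e w p₀| / 2 →
      ∑ v, |fiberMass e (restrictWeight e w p₀ b) p v - (∑ x, w x) / 2 ^ (t + 1)| ≤
        imbalance e (restrictWeight e w p₀ b) p + |signedSum e w p₀| / 2 := by
    intro b h
    have hv : ∀ v, |fiberMass e (restrictWeight e w p₀ b) p v - (∑ x, w x) / 2 ^ (t + 1)| ≤
        |fiberMass e (restrictWeight e w p₀ b) p v -
          (∑ x, restrictWeight e w p₀ b x) / 2 ^ t| + |signedSum e w p₀| / 2 / 2 ^ t := by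
      intro v
      refine (abs_sub_le _ ((∑ x, restrictWeight e w p₀ b x) / 2 ^ t) _).trans ?_
      rw [← h, pow_succ', ← div_div (∑ x, w x), ← sub_div, abs_div,
        abs_of_pos (show (0 : ℝ) < 2 ^ t by positivity)]
    refine (Finset.sum_le_sum fun v _ => hv v).trans (le_of_eq ?_)
    rw [Finset.sum_add_distrib]
    simp only [Finset.sum_const, Finset.card_univ, Fintype.card_fun, ZMod.card, Fintype.card_fin,
      nsmul_eq_mul, Nat.cast_pow, Nat.cast_ofNat]
    rw [mul_div_cancel₀ _ (by positivity)]
    rfl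
  have h0 := hb 0 (by
    rw [← hsum, ← hsub, ← abs_two (α := ℝ), ← abs_div, abs_two]; congr 1; ring)
  have h1 := hb 1 (by
    rw [← hsum, ← hsub, ← abs_neg, ← abs_two (α := ℝ), ← abs_div, abs_two]; congr 1; ring)
  rw [hsplit]
  linarith

/-- The slack `μ` absorbs the term `M * B`, which dominates for parts of tiny mass. Each part
inherits `μ / 2`, so the total of mass plus slack is conserved and each bit costs `s * (∑ x, w x +
μ)`. Failures satisfy `1 + 2 * (2 ^ t - 1) = 2 ^ (t + 1) - 1`. -/
lemma card_imbalance_gt_le [Fintype V] {r M B s : ℝ} (hr : 0 < r) (hM : 0 < M) (hB : 0 < B) (hs : 0 ≤ s)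
    (hsub : ∀ w : Ω → ℝ, (∀ x, 0 ≤ w x) → (∀ x, w x ≤ B) →
      IsSubgaussianBias e w ((∑ x, w x) / √r + M * B))
    (t : ℕ) (w : Ω → ℝ) (hw : ∀ x, 0 ≤ w x) (hwB : ∀ x, w x ≤ B) (μ : ℝ)
    (hμ : M * B * √r * 2 ^ t ≤ 2 * μ) :
    ((Finset.univ.filter fun p : Fin t → V =>
        t * s * (∑ x, w x + μ) < imbalance e w p).card : ℝ) ≤
      (2 ^ t - 1) * (2 * Real.exp (-(s ^ 2 * r / 2))) * Fintype.card V ^ t := by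
  classical
  induction t generalizing w μ with
  | zero =>
    have h0 : ∀ p : Fin 0 → V, imbalance e w p = 0 := by
      intro p
      have h1 : ∀ v, fiberMass e w p v = ∑ x, w x := fun v =>
        Finset.sum_congr rfl fun x _ => if_pos (Subsingleton.elim _ _)
      simp [imbalance, h1]
    simp [h0]
  | succ t ih =>
    set δ := 2 * Real.exp (-(s ^ 2 * r / 2)) with hδ
    set N : ℝ := (Fintype.card V : ℝ) with hN
    have hsr : 0 < √r := Real.sqrt_pos.2 hr
    have hq : 0 ≤ ∑ x, w x := Finset.sum_nonneg fun x _ => hw x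
    have hμ1 : M * B * √r ≤ μ := by
      have h1 : (1 : ℝ) ≤ 2 ^ t := one_le_pow₀ (by norm_num)
      have h2 : M * B * √r * 1 ≤ M * B * √r * 2 ^ t := by gcongr
      rw [pow_succ] at hμ
      linarith
    have hμ0 : 0 < μ := lt_of_lt_of_le (by positivity) hμ1
    have hbad : ((Finset.univ.filter fun p : V =>
        s * (∑ x, w x + μ) < |signedSum e w p|).card : ℝ) ≤ δ * N := by
      refine ((hsub w hw hwB).card_le (by positivity) (by positivity)).trans ?_
      rw [hδ]
      refine mul_le_mul_of_nonneg_right (mul_le_mul_of_nonneg_left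
        (Real.exp_le_exp.2 (neg_le_neg ?_)) zero_le_two) (Nat.cast_nonneg _)
      have hσ : (∑ x, w x) / √r + M * B ≤ (∑ x, w x + μ) / √r := by
        rw [add_div]
        gcongr
        rwa [le_div_iff₀ hsr]
      rw [le_div_iff₀ (by positivity)]
      calc s ^ 2 * r / 2 * (2 * ((∑ x, w x) / √r + M * B) ^ 2)
          ≤ s ^ 2 * r / 2 * (2 * ((∑ x, w x + μ) / √r) ^ 2) := by gcongr
        _ = (s * (∑ x, w x + μ)) ^ 2 := by
            rw [div_pow, Real.sq_sqrt hr.le]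
            field_simp
    have hcard : ((Finset.univ.filter fun p : Fin (t + 1) → V =>
        (t + 1 : ℕ) * s * (∑ x, w x + μ) < imbalance e w p).card : ℝ) =
        ∑ p₀ : V, ((Finset.univ.filter fun p : Fin t → V => (t + 1 : ℕ) * s * (∑ x, w x + μ) <
          imbalance e w (Fin.cons p₀ p : Fin (t + 1) → V)).card : ℝ) := by
      simp only [← Nat.cast_sum, Finset.card_filter]
      rw [← Equiv.sum_comp (Fin.consEquiv fun _ => V), Fintype.sum_prod_type]
      rfl
    -- A bad first polynomial is charged all its continuations; a good one fails only if one of its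
    -- two parts does.
    have hfix : ∀ p₀ : V, ((Finset.univ.filter fun p : Fin t → V =>
        (t + 1 : ℕ) * s * (∑ x, w x + μ) <
          imbalance e w (Fin.cons p₀ p : Fin (t + 1) → V)).card : ℝ) ≤
        (if s * (∑ x, w x + μ) < |signedSum e w p₀| then N ^ t else 0) +
          2 * ((2 ^ t - 1) * δ * N ^ t) := by
      intro p₀
      have h2t : (1 : ℝ) ≤ 2 ^ t := one_le_pow₀ (by norm_num)
      have hnn : 0 ≤ (2 ^ t - 1) * δ * N ^ t := by
        have : (0 : ℝ) ≤ 2 ^ t - 1 := by linarith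
        positivity
      split_ifs with hlt
      · refine le_add_of_le_of_nonneg ?_ (by positivity)
        rw [hN]
        exact_mod_cast (Finset.card_le_univ _).trans (by simp)
      · rw [zero_add, two_mul]
        have hrw : ∀ b x, 0 ≤ restrictWeight e w p₀ b x ∧ restrictWeight e w p₀ b x ≤ B := by
          intro b x
          unfold restrictWeight
          split_ifs
          · exact ⟨hw x, hwB x⟩
          · exact ⟨le_rfl, hB.le⟩
        have hh : M * B * √r * 2 ^ t ≤ 2 * (μ / 2) := by
          rw [pow_succ] at hμ
          linarith
        refine le_trans ?_ (add_le_add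
          (ih (restrictWeight e w p₀ 0) (fun x => (hrw 0 x).1) (fun x => (hrw 0 x).2) (μ / 2) hh)
          (ih (restrictWeight e w p₀ 1) (fun x => (hrw 1 x).1) (fun x => (hrw 1 x).2) (μ / 2) hh))
        rw [← Nat.cast_add, Nat.cast_le]
        refine le_trans (Finset.card_le_card ?_) (Finset.card_union_le _ _)
        intro p hp
        simp only [Finset.mem_union, Finset.mem_filter, Finset.mem_univ, true_and] at hp ⊢
        by_contra! hcon
        have h1 := imbalance_cons_le e w p₀ p
        have h2 := sum_restrictWeight e w p₀
        have h3 : ((t + 1 : ℕ) : ℝ) * s * (∑ x, w x + μ) =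
            t * s * (∑ x, restrictWeight e w p₀ 0 x + μ / 2) +
            t * s * (∑ x, restrictWeight e w p₀ 1 x + μ / 2) + s * (∑ x, w x + μ) := by
          rw [← h2]
          push_cast
          ring
        linarith [hcon.1, hcon.2]
    rw [hcard]
    refine (Finset.sum_le_sum fun p₀ _ => hfix p₀).trans ?_
    rw [Finset.sum_add_distrib, ← Finset.sum_filter, Finset.sum_const, Finset.sum_const,
      nsmul_eq_mul, nsmul_eq_mul, Finset.card_univ, ← hN]
    have h1 : ((Finset.univ.filter fun p : V =>
        s * (∑ x, w x + μ) < |signedSum e w p|).card : ℝ) * N ^ t ≤ δ * N * N ^ t := by gcongr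
    refine (add_le_add_left h1 _).trans (le_of_eq ?_)
    ring

end Iteration

/-! ### Statistical distance and min-entropy -/

section StatDist

variable {α β : Type*} [Fintype α]

lemma PMF.sum_toReal (P : PMF α) : ∑ x, (P x).toReal = 1 := by
  have h := P.tsum_coe
  rw [tsum_fintype] at h
  rw [← ENNReal.toReal_sum fun x _ => P.apply_ne_top x, h, ENNReal.toReal_one]

lemma PMF.toReal_map [DecidableEq β] (f : α → β) (P : PMF α) (y : β) :
    ((P.map f) y).toReal = ∑ x, if f x = y then (P x).toReal else 0 := by
  rw [PMF.map_apply, tsum_fintype, ENNReal.toReal_sum]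
  · refine Finset.sum_congr rfl fun x _ => ?_
    by_cases h : f x = y
    · simp [h]
    · simp [h, Ne.symm h]
  · intro x _
    split_ifs
    · exact P.apply_ne_top x
    · exact ENNReal.zero_ne_top

lemma statDist_nonneg (P Q : PMF α) : 0 ≤ statDist P Q := by
  unfold statDist
  positivity

lemma statDist_triangle (P Q R : PMF α) : statDist P R ≤ statDist P Q + statDist Q R := by
  unfold statDist
  rw [← mul_add, ← Finset.sum_add_distrib]
  gcongr with x
  exact abs_sub_le _ _ _

lemma statDist_map_le [Fintype β] (f : α → β) (P Q : PMF α) :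
    statDist (P.map f) (Q.map f) ≤ statDist P Q := by
  classical
  unfold statDist
  refine mul_le_mul_of_nonneg_left ?_ (by norm_num)
  calc ∑ y, |((P.map f) y).toReal - ((Q.map f) y).toReal|
      ≤ ∑ y, ∑ x, if f x = y then |(P x).toReal - (Q x).toReal| else 0 := by
        refine Finset.sum_le_sum fun y _ => ?_
        rw [PMF.toReal_map, PMF.toReal_map, ← Finset.sum_sub_distrib]
        refine (Finset.abs_sum_le_sum_abs _ _).trans (Finset.sum_le_sum fun x _ => ?_)
        split_ifs <;> simp
    _ = ∑ x, |(P x).toReal - (Q x).toReal| := by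
        rw [Finset.sum_comm]
        simp

/-- `statDist` from a fixed distribution is convex. -/
lemma statDist_map_le_of_isConvexCombination [Fintype β] {𝒳 : Set (PMF α)} {Z : PMF α} (h𝒳 : 𝒳.Finite)
    (hZ : IsConvexCombination 𝒳 Z) (f : α → β) (Q : PMF β) {c : ℝ}
    (hc : ∀ X ∈ 𝒳, statDist (X.map f) Q ≤ c) : statDist (Z.map f) Q ≤ c := by
  obtain ⟨w, rfl⟩ := hZ
  have := h𝒳.fintype
  have hbind : ∀ y, (((w.bind fun X => (X : PMF α)).map f) y).toReal =
      ∑ X : 𝒳, (w X).toReal * (((X : PMF α).map f) y).toReal := by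
    intro y
    rw [PMF.map_bind, PMF.bind_apply, tsum_fintype, ENNReal.toReal_sum]
    · simp
    · exact fun X _ => ENNReal.mul_ne_top (w.apply_ne_top X) (PMF.apply_ne_top _ y)
  have hle : statDist ((w.bind fun X => (X : PMF α)).map f) Q ≤
      ∑ X : 𝒳, (w X).toReal * statDist ((X : PMF α).map f) Q := by
    unfold statDist
    simp only [mul_left_comm _ (1 / 2 : ℝ), ← Finset.mul_sum (a := (1 / 2 : ℝ))]
    refine mul_le_mul_of_nonneg_left ?_ (by norm_num)
    simp only [Finset.mul_sum]
    rw [Finset.sum_comm]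
    refine Finset.sum_le_sum fun y _ => ?_
    have hQ : ∑ X : 𝒳, (w X).toReal * (((X : PMF α).map f) y).toReal - (Q y).toReal =
        ∑ X : 𝒳, (w X).toReal * ((((X : PMF α).map f) y).toReal - (Q y).toReal) := by
      simp only [mul_sub, Finset.sum_sub_distrib]
      rw [← Finset.sum_mul, w.sum_toReal, one_mul]
    rw [hbind, hQ]
    refine (Finset.abs_sum_le_sum_abs _ _).trans (Finset.sum_le_sum fun X _ => ?_)
    rw [abs_mul, abs_of_nonneg ENNReal.toReal_nonneg]
  calc statDist ((w.bind fun X => (X : PMF α)).map f) Q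
      ≤ ∑ X : 𝒳, (w X).toReal * statDist ((X : PMF α).map f) Q := hle
    _ ≤ ∑ X : 𝒳, (w X).toReal * c :=
        Finset.sum_le_sum fun X _ => mul_le_mul_of_nonneg_left (hc X X.2) ENNReal.toReal_nonneg
    _ = c := by rw [← Finset.sum_mul, w.sum_toReal, one_mul]

lemma PMF.toReal_le_of_le_minEntropy (P : PMF α) {k : ℕ} (hk : (k : ℝ) ≤ minEntropy P) (x : α) :
    (P x).toReal ≤ (2 ^ k : ℝ)⁻¹ := by
  by_cases hx : x ∈ P.support
  · have h1 : (k : ℝ) ≤ -Real.logb 2 (P x).toReal :=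
      hk.trans (ciInf_le (Set.finite_range _).bddBelow (⟨x, hx⟩ : P.support))
    have hpos : 0 < (P x).toReal :=
      ENNReal.toReal_pos ((PMF.mem_support_iff P x).1 hx) (P.apply_ne_top x)
    have h2 : Real.logb 2 (P x).toReal ≤ -(k : ℝ) := by linarith
    rw [Real.logb_le_iff_le_rpow one_lt_two hpos, Real.rpow_neg zero_le_two,
      Real.rpow_natCast] at h2
    exact h2
  · rw [PMF.mem_support_iff, not_not] at hx
    rw [hx, ENNReal.toReal_zero]
    positivity

end StatDist

/-! ### Failure probability for one source, and choice of parameters -/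

lemma DegPoly.exists_evalLinear_eq_one (n d : ℕ) : ∃ q, ∀ x, DegPoly.evalLinear n d q x = 1 := by
  have h : monomialFun ∅ ∈ lowDegreeFun n (d + 1) := Submodule.subset_span ⟨∅, by simp, rfl⟩
  obtain ⟨q, hq⟩ := lowDegreeFun_le_range n d h
  exact ⟨q, fun x => by rw [hq]; simp [monomialFun]⟩

lemma statDist_map_polyMap {n d t : ℕ} (X : PMF (Fin n → ZMod 2)) (p : Fin t → DegPoly n d) :
    statDist (X.map (polyMap p)) (PMF.uniformOfFintype (Fin t → ZMod 2)) =
      1 / 2 * imbalance (DegPoly.evalLinear n d) (fun x => (X x).toReal) p := by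
  unfold statDist imbalance
  congr 1
  refine Finset.sum_congr rfl fun v _ => ?_
  have hu : (PMF.uniformOfFintype (Fin t → ZMod 2) v).toReal = 1 / 2 ^ t := by simp
  rw [PMF.toReal_map, X.sum_toReal, hu]
  rfl

lemma card_statDist_gt_le {n d t k l : ℕ} {s : ℝ} (hs : 0 ≤ s) (hl : 0 < l.choose d)
    (hk : 2 * l + t ≤ k) (X : PMF (Fin n → ZMod 2)) (hX : (k : ℝ) ≤ minEntropy X) :
    ((Finset.univ.filter fun p : Fin t → DegPoly n d =>
        t * s < statDist (X.map (polyMap p)) (PMF.uniformOfFintype (Fin t → ZMod 2))).card : ℝ) ≤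
      2 ^ t * (2 * Real.exp (-(s ^ 2 * l.choose d / 2))) * Fintype.card (DegPoly n d) ^ t := by
  have hB : (0 : ℝ) < (2 ^ k)⁻¹ := by positivity
  have hr : (0 : ℝ) < l.choose d := by exact_mod_cast hl
  have hsqrt : √(l.choose d : ℝ) ≤ 2 ^ l := by
    have h1 : (l.choose d : ℝ) ≤ 2 ^ l := by exact_mod_cast Nat.choose_le_two_pow l d
    have h2 : (1 : ℝ) ≤ 2 ^ l := one_le_pow₀ (by norm_num)
    exact Real.sqrt_le_iff.2 ⟨by positivity, by nlinarith⟩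
  have hμ : (2 ^ l : ℕ) * (2 ^ k : ℝ)⁻¹ * √(l.choose d : ℝ) * 2 ^ t ≤ 2 * 1 := by
    have h1 : (2 : ℝ) ^ (2 * l + t) ≤ 2 ^ k := pow_le_pow_right₀ (by norm_num) hk
    calc ((2 ^ l : ℕ) : ℝ) * (2 ^ k : ℝ)⁻¹ * √(l.choose d : ℝ) * 2 ^ t
        ≤ ((2 ^ l : ℕ) : ℝ) * (2 ^ k : ℝ)⁻¹ * 2 ^ l * 2 ^ t := by gcongr
      _ = 2 ^ (2 * l + t) / 2 ^ k := by push_cast; ring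
      _ ≤ 1 := div_le_one_of_le₀ h1 (by positivity)
      _ ≤ 2 * 1 := by norm_num
  have key := card_imbalance_gt_le (DegPoly.evalLinear n d) (r := l.choose d)
    (M := ((2 ^ l : ℕ) : ℝ)) hr (by positivity) hB hs
    (fun w hw hwB => isSubgaussianBias_of_separated (DegPoly.exists_evalLinear_eq_one n d) hl
      (fun S hS => exists_isSeparated_choose_le S hS) hB w hw hwB)
    t (fun x => (X x).toReal) (fun x => ENNReal.toReal_nonneg)
    (X.toReal_le_of_le_minEntropy hX) 1 hμ
  -- Mass `1` plus slack `μ = 1` gives a factor `2`, cancelling the `1 / 2` in `statDist`.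
  rw [X.sum_toReal] at key
  refine le_trans (le_of_eq ?_) (key.trans ?_)
  · congr 2
    refine Finset.filter_congr fun p _ => ?_
    rw [statDist_map_polyMap]
    constructor <;> intro h <;> linarith
  · gcongr
    linarith

lemma randomPolys_real_apply {n d t : ℕ} (A : Set (Fin t → DegPoly n d)) [DecidablePred (· ∈ A)] :
    (randomPolys n d t).real A =
      ((Finset.univ.filter (· ∈ A)).card : ℝ) / Fintype.card (DegPoly n d) ^ t := by
  have hs : ∀ p : Fin t → DegPoly n d, randomPolys n d t {p} =
      ((Fintype.card (DegPoly n d) : ENNReal)⁻¹) ^ t := by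
    intro p
    unfold randomPolys
    rw [MeasureTheory.Measure.pi_singleton]
    simp
  have hA : A = ((Finset.univ.filter (· ∈ A) : Finset _) : Set (Fin t → DegPoly n d)) := by
    ext; simp
  have hm : randomPolys n d t A =
      (Finset.univ.filter (· ∈ A)).card * ((Fintype.card (DegPoly n d) : ENNReal)⁻¹) ^ t := by
    conv_lhs => rw [hA]
    rw [← MeasureTheory.sum_measure_singleton, Finset.sum_congr rfl fun p _ => hs p,
      Finset.sum_const, nsmul_eq_mul]
  rw [MeasureTheory.Measure.real, hm]
  simp [div_eq_mul_inv]

/-- The dimension bound on the number of separated points beats the squared error. -/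
lemma pow_le_sq_mul_choose {k d : ℕ} (hd : 6 ≤ d)
    (hk : (2 * d / (k : ℝ) ^ (1 / 4 : ℝ)) ^ d ≤ 1 / 4) (hk0 : 0 < k) :
    0 < (k / 4).choose d ∧ 30 * (k : ℝ) ^ ((d : ℝ) / 2) ≤
      ((2 * d / (k : ℝ) ^ (1 / 4 : ℝ)) ^ d) ^ 2 * (k / 4).choose d / 2 := by
  have hkr : (0 : ℝ) < k := by exact_mod_cast hk0
  have hd0 : (6 : ℝ) ≤ d := by exact_mod_cast hd
  set u : ℝ := (k : ℝ) ^ (1 / 4 : ℝ) with hu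
  have hu0 : 0 < u := Real.rpow_pos_of_pos hkr _
  have hu4 : u ^ 4 = k := by
    rw [hu, ← Real.rpow_natCast, ← Real.rpow_mul hkr.le]
    norm_num
  -- An error of at most `1 / 4` forces the base `2 * d / u` below `1`, hence `k = u ^ 4` far above
  -- `d`.
  have hud : 2 * d < u := by
    by_contra! h
    have h1 : 1 ≤ 2 * d / u := (one_le_div hu0).2 h
    linarith [one_le_pow₀ h1 (n := d)]
  have hhalf : (k : ℝ) ^ ((d : ℝ) / 2) = (u ^ 2) ^ d := by
    rw [hu, ← pow_mul, ← Real.rpow_natCast, ← Real.rpow_mul hkr.le]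
    congr 1
    push_cast
    ring
  have hkd : 8 * (d : ℝ) ≤ k := by
    have h1 : 12 ≤ u := by linarith
    have h2 : u * 12 ^ 3 ≤ u * u ^ 3 := by gcongr
    rw [← hu4]
    nlinarith
  have hkd' : 8 * d ≤ k := by exact_mod_cast hkd
  have hl : d ≤ k / 4 := by omega
  refine ⟨Nat.choose_pos hl, ?_⟩
  -- From `k ≥ 8 * d`, each of the `d` factors `k / 4 + 1 - d` is at least `k / 8`.
  have hch : ((k : ℝ) / (8 * d)) ^ d ≤ (k / 4).choose d := by
    refine le_trans ?_ (Nat.pow_le_choose d (k / 4))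
    rw [div_pow, mul_pow]
    have h1 : (k : ℝ) / 8 ≤ (k / 4 + 1 - d : ℕ) := by
      have h2 : k ≤ 8 * (k / 4 + 1 - d) := by omega
      have h3 : (k : ℝ) ≤ 8 * ((k / 4 + 1 - d : ℕ) : ℝ) := by exact_mod_cast h2
      linarith
    have h4 : ((d.factorial : ℕ) : ℝ) ≤ (d : ℝ) ^ d := by exact_mod_cast Nat.factorial_le_pow d
    calc (k : ℝ) ^ d / (8 ^ d * d ^ d) = ((k : ℝ) / 8) ^ d / d ^ d := by
          rw [div_pow, div_div]
      _ ≤ _ := by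
          have h5 : (0 : ℝ) < d.factorial := by exact_mod_cast d.factorial_pos
          gcongr
  have hbase : ((2 * d / u) ^ 2 * (k / (8 * d))) ^ d = ((d : ℝ) / 2) ^ d * (u ^ 2) ^ d := by
    rw [← mul_pow, ← hu4]
    congr 1
    field_simp
    ring
  -- This surplus pays for the constant `30` and the division by `2`.
  have hpow : (60 : ℝ) ≤ ((d : ℝ) / 2) ^ d := by
    calc (60 : ℝ) ≤ 3 ^ 6 := by norm_num
      _ ≤ 3 ^ d := pow_le_pow_right₀ (by norm_num) hd
      _ ≤ ((d : ℝ) / 2) ^ d := by gcongr; linarith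
  rw [hhalf]
  calc 30 * (u ^ 2) ^ d = 60 * (u ^ 2) ^ d / 2 := by ring
    _ ≤ ((d : ℝ) / 2) ^ d * (u ^ 2) ^ d / 2 := by gcongr
    _ = ((2 * d / u) ^ d) ^ 2 * (k / (8 * d)) ^ d / 2 := by
        rw [← hbase, mul_pow, ← pow_mul, ← pow_mul, mul_comm 2 d]
    _ ≤ _ := by gcongr

end

/-! ### Union bound over the sources -/

theorem mainTheorem8 :
    ∃ n₀ : ℕ, ∀ n : ℕ, n₀ ≤ n →
      ∀ k : ℕ, 5 * Real.logb 2 n ≤ k →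
      ∀ 𝒳 : Set (PMF (Fin n → ZMod 2)), 𝒳.Finite → (∀ X ∈ 𝒳, (k : ℝ) ≤ minEntropy X) →
      ∀ (ε' : ℝ) (𝒴 : Set (PMF (Fin n → ZMod 2))),
        (∀ Y ∈ 𝒴, ∃ Z, IsConvexCombination 𝒳 Z ∧ statDist Y Z ≤ ε') →
      ∀ d : ℕ, 6 ≤ d → ∀ t : ℕ, t < k →
      ∀ ε : ℝ, ε = (2 * d / (k : ℝ) ^ (1 / 4 : ℝ)) ^ d + ε' → ε ≤ 1 / 4 →
        1 - (𝒳.ncard : ℝ) *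
            Real.exp (3 * n + t + 1
              - 30 * (max ((k : ℝ) - 2 * t) 0) ^ ((d : ℝ) / 2) / (n : ℝ) ^ 2) ≤
          (randomPolys n d t).real {p | IsExtractor (polyMap p) 𝒴 (t * ε)} := by
  classical
  refine ⟨1, fun n hn k _ 𝒳 h𝒳 hX ε' 𝒴 h𝒴 d hd t htk ε hε hε4 => ?_⟩
  have hcardV : (0 : ℝ) < (Fintype.card (DegPoly n d) : ℝ) ^ t := by
    have := Fintype.card_pos (α := DegPoly n d)
    positivity
  have huniv : (∀ p : Fin t → DegPoly n d, IsExtractor (polyMap p) 𝒴 (t * ε)) →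
      1 - (𝒳.ncard : ℝ) * Real.exp (3 * n + t + 1
        - 30 * (max ((k : ℝ) - 2 * t) 0) ^ ((d : ℝ) / 2) / (n : ℝ) ^ 2) ≤
      (randomPolys n d t).real {p | IsExtractor (polyMap p) 𝒴 (t * ε)} := by
    intro h
    rw [randomPolys_real_apply]
    have h1 : (Finset.univ.filter fun p : Fin t → DegPoly n d =>
        p ∈ {p | IsExtractor (polyMap p) 𝒴 (t * ε)}) = Finset.univ :=
      Finset.filter_true_of_mem fun p _ => h p
    rw [h1, Finset.card_univ, Fintype.card_fun, Fintype.card_fin, Nat.cast_pow,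
      div_self hcardV.ne']
    have : 0 ≤ (𝒳.ncard : ℝ) * Real.exp (3 * n + t + 1
        - 30 * (max ((k : ℝ) - 2 * t) 0) ^ ((d : ℝ) / 2) / (n : ℝ) ^ 2) := by positivity
    linarith
  -- A member of `𝒴` yields `ε' ≥ 0` and a member of `𝒳`.
  rcases 𝒴.eq_empty_or_nonempty with rfl | ⟨Y₀, hY₀⟩
  · exact huniv fun p Y hY => absurd hY (Set.notMem_empty Y)
  obtain ⟨Z₀, hZ₀, hYZ₀⟩ := h𝒴 Y₀ hY₀
  have hε'0 : 0 ≤ ε' := (statDist_nonneg _ _).trans hYZ₀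
  obtain ⟨X₀, hX₀⟩ : 𝒳.Nonempty := by
    obtain ⟨w, -⟩ := hZ₀
    obtain ⟨X, -⟩ := w.support_nonempty
    exact ⟨X, X.2⟩
  have hncard : (1 : ℝ) ≤ 𝒳.ncard := by
    exact_mod_cast (Set.ncard_pos h𝒳).2 ⟨X₀, hX₀⟩
  rcases Nat.eq_zero_or_pos t with rfl | ht
  · refine huniv fun p Y _ => ?_
    have h0 : Y.map (polyMap p) = PMF.uniformOfFintype (Fin 0 → ZMod 2) := by
      ext v
      have hone : ∀ P : PMF (Fin 0 → ZMod 2), P v = 1 := fun P => by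
        have := P.tsum_coe
        rwa [tsum_fintype, Fintype.sum_eq_single v fun w hw => absurd (Subsingleton.elim w v) hw]
          at this
      rw [hone, hone]
    rw [h0]
    simp [statDist]
  rcases Nat.lt_or_ge (2 * t) k with h2t | h2t
  swap
  -- For `k ≤ 2 * t` the exponential is at least `1`, so the claimed lower bound is nonpositive.
  · have h1 : max ((k : ℝ) - 2 * t) 0 = 0 := by
      refine max_eq_right ?_
      have : (k : ℝ) ≤ 2 * t := by exact_mod_cast h2t
      linarith
    have hd0 : (d : ℝ) / 2 ≠ 0 := by
      have : (6 : ℝ) ≤ d := by exact_mod_cast hd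
      linarith
    rw [h1, Real.zero_rpow hd0]
    have h2 : 1 ≤ Real.exp (3 * n + t + 1 - 30 * 0 / (n : ℝ) ^ 2) :=
      Real.one_le_exp (by rw [mul_zero, zero_div, sub_zero]; positivity)
    have h3 : 0 ≤ (randomPolys n d t).real {p | IsExtractor (polyMap p) 𝒴 (t * ε)} :=
      MeasureTheory.measureReal_nonneg
    nlinarith
  set s : ℝ := (2 * d / (k : ℝ) ^ (1 / 4 : ℝ)) ^ d with hs
  have hs0 : 0 ≤ s := by positivity
  obtain ⟨hchoose, hexp⟩ := pow_le_sq_mul_choose hd (by linarith : s ≤ 1 / 4) (by omega)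
  set U := PMF.uniformOfFintype (Fin t → ZMod 2)
  let bad (X : PMF (Fin n → ZMod 2)) : Finset (Fin t → DegPoly n d) :=
    Finset.univ.filter fun p => t * s < statDist (X.map (polyMap p)) U
  have hbad : ∀ X ∈ 𝒳, ((bad X).card : ℝ) ≤ Real.exp (3 * n + t + 1
      - 30 * (max ((k : ℝ) - 2 * t) 0) ^ ((d : ℝ) / 2) / (n : ℝ) ^ 2) *
        Fintype.card (DegPoly n d) ^ t := by
    intro X hXmem
    refine (card_statDist_gt_le hs0 hchoose (by omega) X (hX X hXmem)).trans ?_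
    refine mul_le_mul_of_nonneg_right ?_ hcardV.le
    have h2 : (2 : ℝ) ≤ Real.exp 1 := by linarith [Real.add_one_le_exp (1 : ℝ)]
    have hn1 : (1 : ℝ) ≤ n := by exact_mod_cast hn
    have hk2 : max ((k : ℝ) - 2 * t) 0 ≤ k :=
      max_le (by linarith [(Nat.cast_nonneg t : (0 : ℝ) ≤ t)]) (Nat.cast_nonneg k)
    have hdiv : 30 * (max ((k : ℝ) - 2 * t) 0) ^ ((d : ℝ) / 2) / (n : ℝ) ^ 2 ≤
        s ^ 2 * (k / 4).choose d / 2 := by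
      -- Dividing by `n ^ 2 ≥ 1` only weakens the bound, so `n₀ = 1` suffices.
      refine (div_le_self (by positivity) (one_le_pow₀ hn1)).trans (le_trans ?_ hexp)
      have : (max ((k : ℝ) - 2 * t) 0) ^ ((d : ℝ) / 2) ≤ (k : ℝ) ^ ((d : ℝ) / 2) :=
        Real.rpow_le_rpow (le_max_right _ _) hk2 (by positivity)
      linarith
    calc (2 : ℝ) ^ t * (2 * Real.exp (-(s ^ 2 * (k / 4).choose d / 2)))
        ≤ Real.exp 1 ^ t * (Real.exp 1 * Real.exp (-(s ^ 2 * (k / 4).choose d / 2))) := by gcongr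
      _ = Real.exp (t + 1 + -(s ^ 2 * (k / 4).choose d / 2)) := by
          rw [← Real.exp_nat_mul, mul_one, ← Real.exp_add, ← Real.exp_add]
          congr 1
          ring
      _ ≤ _ := Real.exp_le_exp.2 (by linarith)
  have hgood : ∀ p, p ∉ h𝒳.toFinset.biUnion bad → IsExtractor (polyMap p) 𝒴 (t * ε) := by
    intro p hp Y hY
    obtain ⟨Z, hZ, hYZ⟩ := h𝒴 Y hY
    have h1 : statDist (Z.map (polyMap p)) U ≤ t * s := by
      refine statDist_map_le_of_isConvexCombination h𝒳 hZ _ _ fun X hXmem => ?_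
      by_contra! hlt
      exact hp (Finset.mem_biUnion.2 ⟨X, h𝒳.mem_toFinset.2 hXmem,
        Finset.mem_filter.2 ⟨Finset.mem_univ p, hlt⟩⟩)
    have h2 := statDist_triangle (Y.map (polyMap p)) (Z.map (polyMap p)) U
    have h3 := (statDist_map_le (polyMap p) Y Z).trans hYZ
    have ht1 : (1 : ℝ) ≤ t := by exact_mod_cast ht
    -- The error `ε'` is paid once, while `t * ε` allows for it `t` times.
    have h4 : ε' ≤ t * ε' := le_mul_of_one_le_left hε'0 ht1
    rw [hε, mul_add]
    linarith
  rw [randomPolys_real_apply, le_div_iff₀ hcardV]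
  have hunion : ((h𝒳.toFinset.biUnion bad).card : ℝ) ≤ 𝒳.ncard * (Real.exp (3 * n + t + 1
      - 30 * (max ((k : ℝ) - 2 * t) 0) ^ ((d : ℝ) / 2) / (n : ℝ) ^ 2) *
        Fintype.card (DegPoly n d) ^ t) := by
    rw [Set.ncard_eq_toFinset_card 𝒳 h𝒳, ← nsmul_eq_mul]
    refine le_trans (by exact_mod_cast Finset.card_biUnion_le) ((Finset.sum_le_card_nsmul _
      (fun X => ((bad X).card : ℝ)) _ fun X hXmem => hbad X (h𝒳.mem_toFinset.1 hXmem)))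
  have hcover : (Fintype.card (DegPoly n d) : ℝ) ^ t ≤
      (Finset.univ.filter fun p : Fin t → DegPoly n d =>
        p ∈ {p | IsExtractor (polyMap p) 𝒴 (t * ε)}).card +
      (h𝒳.toFinset.biUnion bad).card := by
    have h1 : (Finset.univ : Finset (Fin t → DegPoly n d)) ⊆
        (Finset.univ.filter fun p : Fin t → DegPoly n d =>
          p ∈ {p | IsExtractor (polyMap p) 𝒴 (t * ε)}) ∪ h𝒳.toFinset.biUnion bad := by
      intro p _
      by_cases hp : p ∈ h𝒳.toFinset.biUnion bad
      · exact Finset.mem_union_right _ hp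
      · exact Finset.mem_union_left _ (Finset.mem_filter.2 ⟨Finset.mem_univ p, hgood p hp⟩)
    have h2 := (Finset.card_le_card h1).trans (Finset.card_union_le _ _)
    rw [Finset.card_univ, Fintype.card_fun, Fintype.card_fin] at h2
    exact_mod_cast h2
  linarith
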